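/- Let $\alpha\in(0,1)$ be a rational number, and let $\alpha=[0,a_1,\dots,a_n]=\cfrac{1}{a_1+\cfrac{1}{a_2+\cdots}}$ be any continued fraction expansion of it with positive integers $a_i$ ($n$ even or odd). *The link.* Let $T(\alpha)$ be the associated rational $(2,2)$-tangle diagram: $a_1$ vertical crossings below, then, further inside, $a_2$ horizontal crossings on the right, $a_3$ vertical crossings below, and so on, starting innermost from the tangle $\asymp$ if $n$ is even and $)($ if $n$ is odd; at every crossing the strand from upper left to lower right passes over. Let $D(T(\alpha))$ be its denominator closure (NW joined to SW, NE joined to SE). Write $\alpha=p/q$ in lowest terms. If $q$ is odd, $D(T(\alpha))$ is a knot and is oriented arbitrarily. If $q$ is even, it is a two-component link, oriented so that one of the two closing arcs runs upwards and the other one downwards. Let $\mathrm{wr}(\alpha)$ be the writhe of this oriented diagram, let $\langle\cdot\rangle\in\mathbb Z[A,A^{-1}]$ be the Kauffman bracket of diagrams ($\langle\bigcirc\rangle=1$, $\langle D\sqcup\bigcirc\rangle=(-A^2-A^{-2})\langle D\rangle$, and every crossing equals $A$ times its $A$-smoothing plus $A^{-1}$ times its other smoothing, the $A$-smoothing merging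 the two regions swept out when the upper strand turns counterclockwise), and let $V(\alpha)=(-A^3)^{-\mathrm{wr}(\alpha)}\langle D(T(\alpha))\rangle$ be the Jones polynomial in the variable $A=t^{-1/4}$. *The frieze.* Let $w(\alpha)$ be the word in $L,R$ that records, from right to left, the left and right steps on the path from $\frac12$ to $\alpha$ in the Stern–Brocot tree, and let $\Gamma_\alpha$ be the Conway–Coxeter frieze generated by the rule $ad-bc=1$ from a zigzag of ones that goes from the top line to the bottom line and whose successive steps down to the left ($L$) or to the right ($R$) spell $w(\alpha)$. The Kauffman bracket polynomial of such a frieze is determined by the word along its zigzag of ones (so $\langle\Gamma_\alpha\rangle$ is computed from $w(\alpha)$) through the recursion $$\langle\Gamma_{\beta\sharp\gamma}\rangle=-A^{4}\langle\Gamma_\beta\rangle-A^{-4}\langle\Gamma_\gamma\rangle,\qquad \langle\Gamma_{0/1}\rangle=\langle\Gamma_{1/1}\rangle=1$$ for the parents $\beta=\frac xr<\gamma=\frac ys$ (reduced fractions in $[0,1]$ with $ry-xs=1$) of $\beta\sharp\gamma=\frac{x+y}{r+s}$; here $\langle\Gamma_{0/1}\rangle$ and $\langle\Gamma_{1/1}\rangle$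 are just names for the initial values. *The weights.* Let $\mathrm{wt}(\alpha)=-a_1+a_2-\cdots+a_n$ if $n$ is even and $\mathrm{wt}(\alpha)=-a_1+a_2-\cdots-a_n+2$ if $n$ is odd, and let $\widetilde{\mathrm{wt}}(\alpha)=-\mathrm{wr}(\alpha)-\mathrm{wt}(\alpha)$. Then $D(T(\alpha))$ has an orientation as described, $$\langle\Gamma_\alpha\rangle=(-A^3)^{\mathrm{wt}(\alpha)}\langle D(T(\alpha))\rangle ,$$ and, for every such orientation, the Jones polynomial of the rational link $D(T(\alpha))$ is $$V(\alpha)=(-A^3)^{\widetilde{\mathrm{wt}}(\alpha)}\,\langle\Gamma_\alpha\rangle .$$ -/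

import Mathlib

namespace RationalLink

/-! ### Laurent polynomials in `A` -/

/-- The ring `ℤ[A, A⁻¹]`; the power `A ^ k` is `LaurentPolynomial.T k`. -/
abbrev Laurent : Type := LaurentPolynomial ℤ

/-- The power `A ^ k`, for `k : ℤ`. -/
noncomputable abbrev Apow (k : ℤ) : Laurent := LaurentPolynomial.T k

/-- The loop value `δ = -A² - A⁻²`. -/
noncomputable def loopValue : Laurent := -Apow 2 - Apow (-2)

/-- `-A³`, as a unit of `ℤ[A, A⁻¹]`. -/
noncomputable def negACubed : Laurentˣ where
  val := -Apow 3
  inv := -Apow (-3)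
  val_inv := by
    rw [neg_mul_neg, ← LaurentPolynomial.T_add]; simp
  inv_val := by
    rw [neg_mul_neg, ← LaurentPolynomial.T_add]; simp

/-- `(-A³) ^ k`, for `k : ℤ`. -/
noncomputable def negACubedPow (k : ℤ) : Laurent := ((negACubed ^ k : Laurentˣ) : Laurent)

/-! ### Link diagrams, given by planar diagram codes

The arcs of a diagram are numbered `0, …, arcs - 1`. The arc `x` has the two ends `(x, false)` and
`(x, true)`. Arcs are tied together at crossings (four arc ends) and at joins (two arc ends). -/

/-- An end of an arc. -/
abbrev ArcEnd : Type := ℕ × Bool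

/-- A crossing: the four arc ends that meet there, listed counterclockwise, starting with an end of
the strand that passes below. So `u₁ u₂` is the lower strand and `o₁ o₂` the upper one. -/
structure Crossing where
  u₁ : ArcEnd
  o₁ : ArcEnd
  u₂ : ArcEnd
  o₂ : ArcEnd

/-- A link diagram. -/
structure Diagram where
  arcs : ℕ
  crossings : List Crossing
  joins : List (ArcEnd × ArcEnd)

/-- The number of closed curves that are obtained from `m` arcs by joining them at the listed pairs
of ends. -/
noncomputable def loopCount (m : ℕ) (joins : List (ArcEnd × ArcEnd)) : ℕ :=
  Nat.card (Quot fun x y : Fin m => ∃ j ∈ joins, j.1.1 = (x : ℕ) ∧ j.2.1 = (y : ℕ))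

/-- The Kauffman bracket of the diagram with `m` arcs, the given joins and the given crossings:
every crossing is replaced by `A` times its `A`-smoothing (the one that merges the two regions swept
out by the upper strand when it turns counterclockwise) plus `A⁻¹` times its other smoothing, and
`k` disjoint closed curves have bracket `δ ^ (k - 1)`. -/
noncomputable def bracketAux (m : ℕ) : List (ArcEnd × ArcEnd) → List Crossing → Laurent
  | joins, [] => loopValue ^ (loopCount m joins - 1)
  | joins, c :: cs =>
      Apow 1 * bracketAux m ((c.u₁, c.o₁) :: (c.u₂, c.o₂) :: joins) cs
        + Apow (-1) * bracketAux m ((c.u₁, c.o₂) :: (c.o₁, c.u₂) :: joins) cs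

/-- The Kauffman bracket polynomial `⟨D⟩`, normalized to be `1` on the circle. -/
noncomputable def Diagram.bracket (D : Diagram) : Laurent :=
  bracketAux D.arcs D.joins D.crossings

/-- `ω` directs every arc: `ω x = true` means that the arc `x` runs from `(x, false)` to
`(x, true)`. Then `headsTo ω e` says that the arc of `e` runs towards its end `e`. -/
def headsTo (ω : ℕ → Bool) (e : ArcEnd) : Prop := ω e.1 = e.2

instance (ω : ℕ → Bool) (e : ArcEnd) : Decidable (headsTo ω e) :=
  inferInstanceAs (Decidable (ω e.1 = e.2))

/-- Two arc ends continue each other consistently: one arc arrives where the other leaves. -/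
def continues (ω : ℕ → Bool) (e f : ArcEnd) : Prop := headsTo ω e ↔ ¬ headsTo ω f

/-- `ω` is an orientation of the link diagram `D`. -/
def Diagram.IsOrientation (D : Diagram) (ω : ℕ → Bool) : Prop :=
  (∀ c ∈ D.crossings, continues ω c.u₁ c.u₂ ∧ continues ω c.o₁ c.o₂) ∧
    ∀ j ∈ D.joins, continues ω j.1 j.2

/-- The sign of a crossing: it is `1` if the direction of the upper strand has to be turned
counterclockwise (by less than a straight angle) to reach the direction of the lower strand, that
is, if the strands run `u₁ → u₂` and `o₂ → o₁`, or both the other way; otherwise it is `-1`. -/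
def Crossing.sign (ω : ℕ → Bool) (c : Crossing) : ℤ :=
  if headsTo ω c.u₁ ↔ headsTo ω c.o₂ then 1 else -1

/-- The writhe of an oriented diagram. -/
def Diagram.writhe (D : Diagram) (ω : ℕ → Bool) : ℤ :=
  (D.crossings.map (Crossing.sign ω)).sum

/-- The Jones polynomial of the oriented link with diagram `D` and orientation `ω`,
`(-A³) ^ (-wr) ⟨D⟩`, in the variable `A` (where `t = A⁻⁴`). -/
noncomputable def Diagram.jones (D : Diagram) (ω : ℕ → Bool) : Laurent :=
  negACubedPow (-D.writhe ω) * D.bracket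

/-! ### Rational tangles -/

/-- A `(2,2)`-tangle diagram, with free arc ends at its four corners. -/
structure Tangle where
  arcs : ℕ
  crossings : List Crossing
  nw : ArcEnd
  ne : ArcEnd
  sw : ArcEnd
  se : ArcEnd

/-- The tangle `≍` of two horizontal arcs. -/
def Tangle.zero : Tangle where
  arcs := 2
  crossings := []
  nw := (0, false)
  ne := (0, true)
  sw := (1, false)
  se := (1, true)

/-- The tangle `)(` of two vertical arcs. -/
def Tangle.infinity : Tangle where
  arcs := 2
  crossings := []
  nw := (0, false)
  sw := (0, true)
  ne := (1, false)
  se := (1, true)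

/-- Adds one crossing on the right, between the ends NE and SE. The strand of the new crossing that
goes from upper left to lower right passes above. -/
def Tangle.addRight (T : Tangle) : Tangle where
  arcs := T.arcs + 2
  crossings :=
    { u₁ := T.se, o₁ := (T.arcs + 1, false), u₂ := (T.arcs, false), o₂ := T.ne } :: T.crossings
  nw := T.nw
  ne := (T.arcs, true)
  sw := T.sw
  se := (T.arcs + 1, true)

/-- Adds one crossing at the bottom, between the ends SW and SE. The strand of the new crossing that
goes from upper left to lower right passes above. -/
def Tangle.addBottom (T : Tangle) : Tangle where
  arcs := T.arcs + 2
  crossings :=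
    { u₁ := (T.arcs, false), o₁ := (T.arcs + 1, false), u₂ := T.se, o₂ := T.sw } :: T.crossings
  nw := T.nw
  ne := T.ne
  sw := (T.arcs, true)
  se := (T.arcs + 1, true)

mutual
/-- The rational tangle diagram `T([0, a₁, …, aₙ])`: `a₁` vertical twists below the tangle with
`a₂` horizontal twists to the right of the tangle with `a₃` vertical twists …; the innermost tangle
is `≍` if `n` is even and `)(` if `n` is odd. -/
def rationalTangle : List ℕ → Tangle
  | [] => Tangle.zero
  | a :: l => Tangle.addBottom^[a] (rationalTangleHor l)
/-- The same, with the first entry counting horizontal twists: the tangle of `a₁ + [0, a₂, …]`. -/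
def rationalTangleHor : List ℕ → Tangle
  | [] => Tangle.infinity
  | a :: l => Tangle.addRight^[a] (rationalTangle l)
end

/-- The denominator closure `D(T)`: NW is joined to SW and NE to SE. -/
def Tangle.denominator (T : Tangle) : Diagram where
  arcs := T.arcs
  crossings := T.crossings
  joins := [(T.nw, T.sw), (T.ne, T.se)]

/-- The value of the continued fraction `[0, a₁, …, aₙ] = 1 / (a₁ + 1 / (a₂ + ⋯))`. -/
def contFrac : List ℕ → ℚ
  | [] => 0
  | a :: l => 1 / ((a : ℚ) + contFrac l)

/-- The diagram `D(T([0, a₁, …, aₙ]))` of a rational link. -/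
def rationalLink (a : List ℕ) : Diagram := (rationalTangle a).denominator

/-- The chosen orientation of the rational link `D(T(p/q))`, up to reversal of the whole link. If
`q` is odd, the link is a knot and there is no choice. If `q` is even, the two closing arcs belong
to different components, and one of them runs upwards and the other one downwards: the tangle is
left at SW exactly if it is left at NE. -/
def IsStandardOrientation (a : List ℕ) (ω : ℕ → Bool) : Prop :=
  (rationalLink a).IsOrientation ω ∧
    (Even (contFrac a).den →
      (headsTo ω (rationalTangle a).sw ↔ headsTo ω (rationalTangle a).ne))

/-- `-a₁ + a₂ - ⋯ ± aₙ`. -/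
def altSum : List ℕ → ℤ
  | [] => 0
  | a :: l => -((a : ℤ) + altSum l)

/-- The weight `wt([0, a₁, …, aₙ])`. -/
def weight (a : List ℕ) : ℤ :=
  if Even a.length then altSum a else altSum a + 2

/-- The extended weight `-wr(α) - wt(α)`. -/
def extWeight (a : List ℕ) (ω : ℕ → Bool) : ℤ :=
  -(rationalLink a).writhe ω - weight a

/-! ### Words in `L`, `R` and zigzag friezes -/

/-- The letters `L` and `R`. -/
inductive Letter where
  | L
  | R
  deriving DecidableEq

/-- Descent in the Stern–Brocot tree between the fractions `p / q < r / s`, towards `α`. The letters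
of the steps are put down from right to left, in front of the word `w`. -/
def sternBrocotWord (α : ℚ) : ℕ → ℕ → ℕ → ℕ → ℕ → List Letter → List Letter
  | 0, _, _, _, _, w => w
  | n + 1, p, q, r, s, w =>
      if α < ((p + r : ℕ) : ℚ) / ((q + s : ℕ) : ℚ) then
        sternBrocotWord α n p q (p + r) (q + s) (Letter.L :: w)
      else if ((p + r : ℕ) : ℚ) / ((q + s : ℕ) : ℚ) < α then
        sternBrocotWord α n (p + r) (q + s) r s (Letter.R :: w)
      else w

/-- The word `w(α)` of a rational number `α` in `(0, 1)`: the path from `1/2` to `α` in the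
Stern–Brocot tree, written from right to left. (The length of the path is less than the denominator
of `α`, so the number of steps allowed here is large enough.) -/
def wordOf (α : ℚ) : List Letter := sternBrocotWord α α.den 0 1 1 1 []

/-- A frieze pattern, drawn on shifted lines: `entry k x` is the number on line `k` in column `x`.
The lines `0` and `width + 1` are the top and the bottom line. Neighbouring numbers of a line are
two columns apart and consecutive lines are shifted by one column, so that a unit diamond consists
of the left and right numbers `entry k (x - 1)`, `entry k (x + 1)`, the upper number
`entry (k - 1) x` and the lower number `entry (k + 1) x`. Line `1` occupies the even columns; values
at places that are not occupied have no meaning. -/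
structure Frieze where
  width : ℕ
  entry : ℕ → ℤ → ℚ

/-- The column of a step: `L` goes down to the left and `R` down to the right. -/
def Letter.step : Letter → ℤ
  | Letter.L => -1
  | Letter.R => 1

/-- The word with `L` and `R` interchanged. -/
def swapLetters (w : List Letter) : List Letter :=
  w.map fun
    | Letter.L => Letter.R
    | Letter.R => Letter.L

/-- The column on line `k ≥ 1` of the zigzag path of ones that begins on line `1` in column `0` and
follows the word `w`. -/
def zigzagColumn (w : List Letter) (k : ℕ) : ℤ := ((w.take (k - 1)).map Letter.step).sum

/-- The frieze to the right of the zigzag of ones, generated column by column. `sweep w t k` is the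
last number on line `k` in the columns up to `t - |w|`, and `1` as long as the zigzag has not been
reached. A new number on line `k` is `(1 + b c) / a`, by the rule `a d - b c = 1`. -/
def sweep (w : List Letter) : ℕ → ℕ → ℚ
  | 0, _ => 1
  | t + 1, k =>
      if 1 ≤ k ∧ k ≤ w.length + 1 ∧ zigzagColumn w k < (t + 1 : ℤ) - w.length ∧
          Even ((t + 1 : ℤ) - w.length - zigzagColumn w k) then
        (1 + sweep w t (k - 1) * sweep w t (k + 1)) / sweep w t k
      else sweep w t k

/-- The zigzag frieze `Γ(w)`: it has ones along the zigzag path of `w`, and the rule `a d - b c = 1`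
generates it from there to the right and, by reflection, to the left. -/
def zigzagFrieze (w : List Letter) : Frieze where
  width := w.length + 1
  entry k x :=
    if zigzagColumn w k ≤ x then sweep w (x + w.length).toNat k
    else sweep (swapLetters w) (-x + w.length).toNat k

/-- The frieze `Γ_α` of a rational number `α` in `(0, 1)`. -/
def friezeOf (α : ℚ) : Frieze := zigzagFrieze (wordOf α)

/-- Follows a path of ones downwards for `n` steps from line `k` and column `x` and records its
letters: `L` if the lower left neighbour is `1`, and `R` otherwise. -/
def readWord (Γ : Frieze) : ℕ → ℕ → ℤ → List Letter
  | 0, _, _ => []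
  | n + 1, k, x =>
      if Γ.entry (k + 1) (x - 1) = 1 then Letter.L :: readWord Γ n (k + 1) (x - 1)
      else Letter.R :: readWord Γ n (k + 1) (x + 1)

/-- The word of the path of ones in `Γ` that begins on line `1` in column `0`. -/
def Frieze.word (Γ : Frieze) : List Letter := readWord Γ (Γ.width - 1) 1 0

/-- The bracket of a Farey sum `β ♯ γ` from those of its left parent `β` and its right parent `γ`. -/
noncomputable def fareyBracket (x y : Laurent) : Laurent := -Apow 4 * x - Apow (-4) * y

/-- The brackets of the left and the right parent of the rational number with word `w`. The parents
of `1/2`, which has the empty word, are `0/1` and `1/1`, both with bracket `1`. The word `L w`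
belongs to the Farey sum of the left parent of `w` and `w` itself, the word `R w` to the Farey sum
of `w` itself and its right parent. -/
noncomputable def parentBrackets : List Letter → Laurent × Laurent
  | [] => (1, 1)
  | Letter.L :: w => ((parentBrackets w).1, fareyBracket (parentBrackets w).1 (parentBrackets w).2)
  | Letter.R :: w => (fareyBracket (parentBrackets w).1 (parentBrackets w).2, (parentBrackets w).2)

/-- The Kauffman bracket polynomial `⟨Γ⟩` of a zigzag frieze: the deformation with the weights
`-A⁴` and `-A⁻⁴` of the recursion for the largest number of the frieze (the denominator of `α`,
which is the sum of the denominators of the parents of `α`), taken along its zigzag of ones. -/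
noncomputable def Frieze.bracket (Γ : Frieze) : Laurent :=
  fareyBracket (parentBrackets Γ.word).1 (parentBrackets Γ.word).2

end RationalLink

open RationalLink

namespace RationalLink

-- The bracket identity is a duality between Kauffman's skein relation and the Farey recursion.
-- Expanding its crossings turns a tangle into x times ≍ plus y times )(, valid inside every outside
-- closure. A crossing acts linearly on (x, y): on the right by (x, y) ↦ (A x, A⁻¹ x - A⁻³ y), at
-- the bottom by (x, y) ↦ (-A³ x + A y, A⁻¹ y) (`Tangle.HasSkein.addRight`,
-- `Tangle.HasSkein.addBottom`).
--
-- A step in the Stern–Brocot tree acts linearly on the pair (v₁, v₂) of parent brackets. Under the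
-- pairing x v₁ + A⁻⁶ y v₂ a bottom crossing is -A³ times the adjoint of a left step, and a right
-- crossing is (-A³)⁻¹ times the adjoint of a right step. Adjoints reverse the order of composition,
-- so a tangle built from the inside outwards matches a descent that reads a₁ first. The accumulated
-- powers of -A³ form the alternating sum of the entries, and the A⁻⁶ met at an innermost )( gives
-- the extra 2 for odd length (`rationalTangle_hasSkein`).
--
-- The denominator closure has bracket x + δ y, which is the pairing with (1, A⁶ δ) = (1, -A⁴ - A⁸).
-- This second entry is a virtual bracket at 1/0: one left step turns the pair into (1, 1), the
-- initial values at 0/1 and 1/1. Hence the descent from (0, ∞) computes the bracket given by the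
-- word of α (`fareyBracket_wordOf`). That word is recovered from the frieze because the wrong
-- neighbour of a one on the zigzag exceeds 1 (`word_friezeOf`).
--
-- The Jones formula then only adds exponents. Existence of the orientation is a parity matter: how
-- the strands connect the four corners depends on p and q modulo 2 (`rationalTangle_orientsLike`).

-- Counting closed curves under contraction of arcs

/-- The arcs `a` and `b` lie on the same closed curve. -/
def SameLoop (m : ℕ) (J : List (ArcEnd × ArcEnd)) (a b : ℕ) : Prop :=
  ∃ (ha : a < m) (hb : b < m),
    Quot.mk (fun x y : Fin m => ∃ j ∈ J, j.1.1 = (x : ℕ) ∧ j.2.1 = (y : ℕ)) ⟨a, ha⟩ =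
      Quot.mk _ ⟨b, hb⟩

namespace SameLoop

variable {m : ℕ} {J : List (ArcEnd × ArcEnd)} {a b c : ℕ}

theorem refl (ha : a < m) : SameLoop m J a a := ⟨ha, ha, rfl⟩

theorem symm : SameLoop m J a b → SameLoop m J b a := fun ⟨ha, hb, h⟩ => ⟨hb, ha, h.symm⟩

theorem trans : SameLoop m J a b → SameLoop m J b c → SameLoop m J a c :=
  fun ⟨ha, _, h⟩ ⟨_, hc, h'⟩ => ⟨ha, hc, h.trans h'⟩

theorem of_mem {j : ArcEnd × ArcEnd} (hj : j ∈ J) (h1 : j.1.1 < m) (h2 : j.2.1 < m) :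
    SameLoop m J j.1.1 j.2.1 := ⟨h1, h2, Quot.sound ⟨j, hj, rfl, rfl⟩⟩

end SameLoop

/-- Joins between relabelled arcs. -/
def relabel (f : ArcEnd → ℕ) (J : List (ArcEnd × ArcEnd)) : List (ArcEnd × ArcEnd) :=
  J.map fun j => ((f j.1, false), (f j.2, false))

theorem sameLoop_relabel {m : ℕ} {f : ArcEnd → ℕ} {J : List (ArcEnd × ArcEnd)} {a b : ArcEnd}
    (h : (a, b) ∈ J ∨ (b, a) ∈ J) (ha : f a < m) (hb : f b < m) :
    SameLoop m (relabel f J) (f a) (f b) := by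
  rcases h with h | h
  · exact SameLoop.of_mem (j := ((f a, false), (f b, false)))
      (List.mem_map.2 ⟨(a, b), h, rfl⟩) ha hb
  · exact (SameLoop.of_mem (j := ((f b, false), (f a, false)))
      (List.mem_map.2 ⟨(b, a), h, rfl⟩) hb ha).symm

/-- Contracting arcs along joins does not change the number of closed curves. -/
theorem loopCount_contract {m m' : ℕ} {E J : List (ArcEnd × ArcEnd)} {f g : ArcEnd → ℕ}
    (π σ : ℕ → ℕ) (hπ : ∀ x < m, π x < m') (hσ : ∀ x < m', σ x < m)
    (hπσ : ∀ x < m', π (σ x) = x)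
    (hf : ∀ j ∈ J, f j.1 < m ∧ f j.2 < m)
    (hg : ∀ j ∈ J, g j.1 = π (f j.1) ∧ g j.2 = π (f j.2))
    (hE : ∀ j ∈ E, π (f j.1) = π (f j.2))
    (hc : ∀ x < m, SameLoop m (relabel f (E ++ J)) (σ (π x)) x) :
    loopCount m (relabel f (E ++ J)) = loopCount m' (relabel g J) := by
  refine Nat.card_congr
    ⟨Quot.lift (fun x => Quot.mk _ ⟨π x, hπ _ x.2⟩) ?_,
      Quot.lift (fun x => Quot.mk _ ⟨σ x, hσ _ x.2⟩) ?_, ?_, ?_⟩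
  · rintro x y ⟨j, hj, hx, hy⟩
    obtain ⟨i, hi, rfl⟩ := List.mem_map.1 hj
    rcases List.mem_append.1 hi with hi | hi
    · have := hE i hi
      simp only at hx hy
      rw [hx, hy] at this
      simp only [this]
    · refine Quot.sound ⟨((g i.1, false), (g i.2, false)), List.mem_map.2 ⟨i, hi, rfl⟩, ?_, ?_⟩
      · simp [(hg i hi).1, ← hx]
      · simp [(hg i hi).2, ← hy]
  · rintro x y ⟨j, hj, hx, hy⟩
    obtain ⟨i, hi, rfl⟩ := List.mem_map.1 hj
    simp only at hx hy
    obtain ⟨h1, h2⟩ := hf i hi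
    have h := ((hc _ h1).trans
      (sameLoop_relabel (J := E ++ J) (a := i.1) (b := i.2) (Or.inl (by simp [hi])) h1 h2)).trans
        (hc _ h2).symm
    -- The section is well defined on classes because it picks a representative on the same curve as
    -- each end of the original join.
    rw [← (hg i hi).1, ← (hg i hi).2, hx, hy] at h
    exact h.2.2
  · rintro ⟨x⟩
    exact (hc x x.2).2.2
  · rintro ⟨x⟩
    simp [hπσ x x.2]

/-- An additional arc without joins is a closed curve of its own. -/
theorem loopCount_succ {m : ℕ} {J : List (ArcEnd × ArcEnd)}
    (hJ : ∀ j ∈ J, j.1.1 < m ∧ j.2.1 < m) : loopCount (m + 1) J = loopCount m J + 1 := by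
  have : loopCount (m + 1) J = Nat.card (Option
      (Quot fun x y : Fin m => ∃ j ∈ J, j.1.1 = (x : ℕ) ∧ j.2.1 = (y : ℕ))) := by
    refine Nat.card_congr
      ⟨Quot.lift (fun x => if h : (x : ℕ) < m then some (Quot.mk _ ⟨x, h⟩) else none) ?_,
        fun o => o.elim (Quot.mk _ (Fin.last m))
          (Quot.lift (fun x => Quot.mk _ x.castSucc) ?_), ?_, ?_⟩
    · rintro x y ⟨j, hj, hx, hy⟩
      obtain ⟨h1, h2⟩ := hJ j hj
      rw [hx] at h1
      rw [hy] at h2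
      simp only [h1, h2, dite_true]
      exact congrArg some (Quot.sound ⟨j, hj, hx, hy⟩)
    · rintro x y ⟨j, hj, hx, hy⟩
      exact Quot.sound ⟨j, hj, by simpa using hx, by simpa using hy⟩
    · rintro ⟨x⟩
      by_cases h : (x : ℕ) < m
      · simp [h]
      · have : x = Fin.last m := Fin.ext (by have := x.2; simp; omega)
        subst this
        simp
    · rintro (_ | x)
      · simp
      · induction x using Quot.ind
        simp
  rw [this, Finite.card_option]
  rfl

theorem loopCount_pos {m : ℕ} (hm : 0 < m) (J : List (ArcEnd × ArcEnd)) : 0 < loopCount m J := by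
  have : Nonempty (Quot fun x y : Fin m => ∃ j ∈ J, j.1.1 = (x : ℕ) ∧ j.2.1 = (y : ℕ)) :=
    ⟨Quot.mk _ ⟨0, hm⟩⟩
  exact Nat.card_pos

/-- Only the arc numbers of a join enter the count, so `relabel` may forget which end is meant. This
serves the two tangles without crossings. -/
theorem loopCount_relabel_of_eq {m : ℕ} {f : ArcEnd → ℕ} {J : List (ArcEnd × ArcEnd)}
    (h : ∀ j ∈ J, f j.1 = j.1.1 ∧ f j.2 = j.2.1) : loopCount m (relabel f J) = loopCount m J := by
  unfold loopCount
  congr! 4 with x y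
  constructor
  · rintro ⟨j, hj, hx, hy⟩
    obtain ⟨i, hi, rfl⟩ := List.mem_map.1 hj
    exact ⟨i, hi, (h i hi).1.symm.trans hx, (h i hi).2.symm.trans hy⟩
  · rintro ⟨i, hi, hx, hy⟩
    exact ⟨_, List.mem_map.2 ⟨i, hi, rfl⟩, (h i hi).1.trans hx, (h i hi).2.trans hy⟩

-- The four smoothing pictures at a new crossing

/-- The arcs after a tangle with `n` arcs and the ends `p`, `q`, `r`, `s` has been replaced by the
arc `0` from `p` to `r` and the arc `1` from `q` to `s`. -/
def label (p q r s : ArcEnd) (n : ℕ) (e : ArcEnd) : ℕ :=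
  if e = p ∨ e = r then 0 else if e = q ∨ e = s then 1 else e.1 - n + 2

/-- The end `e` is one of `p`, `q`, `r`, `s` or belongs to one of the arcs `n, …, n + k - 1`. -/
def IsOuter (p q r s : ArcEnd) (n k : ℕ) (e : ArcEnd) : Prop :=
  (e = p ∨ e = q ∨ e = r ∨ e = s) ∨ n ≤ e.1 ∧ e.1 < n + k

/-- The ends `p`, `q`, `r`, `s` are different and belong to the arcs `0, …, n - 1`. -/
structure GoodEnds (p q r s : ArcEnd) (n : ℕ) : Prop where
  pq : p ≠ q
  pr : p ≠ r
  ps : p ≠ s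
  qr : q ≠ r
  qs : q ≠ s
  rs : r ≠ s
  p_lt : p.1 < n
  q_lt : q.1 < n
  r_lt : r.1 < n
  s_lt : s.1 < n

section Smoothing

variable {p q r s : ArcEnd} {n k : ℕ} {J E : List (ArcEnd × ArcEnd)}

/-- Reflection in the diagonal through NW and SE. It exchanges ≍ with )( and lets a bottom crossing
reuse the loop counts for a right crossing. -/
theorem GoodEnds.swap (h : GoodEnds p q r s n) : GoodEnds p r q s n :=
  ⟨h.pr, h.pq, h.ps, h.qr.symm, h.rs, h.qs, h.p_lt, h.r_lt, h.q_lt, h.s_lt⟩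

theorem GoodEnds.next (h : GoodEnds p q r s n) : GoodEnds p q (n, true) (n + 1, true) (n + 2) := by
  have := h.p_lt
  have := h.q_lt
  have := h.pq
  constructor <;> first | assumption | omega | (intro e; simp_all)

theorem label_outer (h : GoodEnds p q r s n) {e : ArcEnd} (he : n ≤ e.1) :
    label p q r s n e = e.1 - n + 2 := by
  have h1 := h.p_lt
  have h2 := h.q_lt
  have h3 := h.r_lt
  have h4 := h.s_lt
  unfold label
  rw [if_neg, if_neg]
  · rintro (rfl | rfl) <;> omega
  · rintro (rfl | rfl) <;> omega

theorem label_first : label p q r s n p = 0 := by simp [label]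

theorem label_third : label p q r s n r = 0 := by simp [label]

theorem label_second (h : GoodEnds p q r s n) : label p q r s n q = 1 := by
  simp [label, h.pq.symm, h.qr]

theorem label_fourth (h : GoodEnds p q r s n) : label p q r s n s = 1 := by
  simp [label, h.ps.symm, h.rs.symm]

theorem label_lt {e : ArcEnd} (he : IsOuter p q r s n k e) : label p q r s n e < k + 2 := by
  unfold label
  split_ifs with h1 h2
  · omega
  · omega
  · rcases he with (rfl | rfl | rfl | rfl) | he
    · simp at h1
    · simp at h2
    · simp at h1
    · simp at h2
    · omega

/-- The joins `E` continue the ends `r` and `s` by the next two arcs. -/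
structure IsThrough (r s : ArcEnd) (n : ℕ) (E : List (ArcEnd × ArcEnd)) : Prop where
  fst : (r, (n, false)) ∈ E ∨ ((n, false), r) ∈ E
  snd : (s, (n + 1, false)) ∈ E ∨ ((n + 1, false), s) ∈ E
  only : ∀ j ∈ E, j = (r, (n, false)) ∨ j = ((n, false), r) ∨
    j = (s, (n + 1, false)) ∨ j = ((n + 1, false), s)

/-- The joins `E` tie the ends `r` and `s` together, and likewise the next two arcs. -/
structure IsCap (r s : ArcEnd) (n : ℕ) (E : List (ArcEnd × ArcEnd)) : Prop where
  snd : ((n, false), (n + 1, false)) ∈ E ∨ ((n + 1, false), (n, false)) ∈ E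
  fst : (r, s) ∈ E ∨ (s, r) ∈ E
  only : ∀ j ∈ E, j = (r, s) ∨ j = (s, r) ∨
    j = ((n, false), (n + 1, false)) ∨ j = ((n + 1, false), (n, false))

theorem IsOuter.swap {e : ArcEnd} (h : IsOuter p q r s n k e) : IsOuter p r q s n k e := by
  unfold IsOuter at *
  tauto

theorem label_new_fst (h : GoodEnds p q r s n) (b : Bool) : label p q r s n (n, b) = 2 := by
  simp [label_outer h (e := (n, b)) le_rfl]

theorem label_new_snd (h : GoodEnds p q r s n) (b : Bool) : label p q r s n (n + 1, b) = 3 := by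
  simp [label_outer h (e := (n + 1, b)) (Nat.le_succ n)]

/-- The places of an outer end before and after an additional crossing. -/
theorem label_cases (h : GoodEnds p q r s n) {e : ArcEnd}
    (he : IsOuter p q (n, true) (n + 1, true) (n + 2) k e) :
    (label p q r s n e = 0 ∧ label p r q s n e = 0 ∧
        label p q (n, true) (n + 1, true) (n + 2) e = 0 ∧
        label p (n, true) q (n + 1, true) (n + 2) e = 0) ∨
      (label p q r s n e = 1 ∧ label p r q s n e = 0 ∧
        label p q (n, true) (n + 1, true) (n + 2) e = 1 ∧
        label p (n, true) q (n + 1, true) (n + 2) e = 0) ∨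
      (label p q r s n e = 2 ∧ label p r q s n e = 2 ∧
        label p q (n, true) (n + 1, true) (n + 2) e = 0 ∧
        label p (n, true) q (n + 1, true) (n + 2) e = 1) ∨
      (label p q r s n e = 3 ∧ label p r q s n e = 3 ∧
        label p q (n, true) (n + 1, true) (n + 2) e = 1 ∧
        label p (n, true) q (n + 1, true) (n + 2) e = 1) ∨
      (4 ≤ label p q r s n e ∧ label p q r s n e < k + 4 ∧
        label p r q s n e = label p q r s n e ∧
        label p q (n, true) (n + 1, true) (n + 2) e + 2 = label p q r s n e ∧
        label p (n, true) q (n + 1, true) (n + 2) e + 2 = label p q r s n e) := by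
  have h' := h.swap
  have g := h.next
  have g' := h.next.swap
  rcases he with (rfl | rfl | rfl | rfl) | he
  · exact Or.inl ⟨label_first, label_first, label_first, label_first⟩
  · exact Or.inr (Or.inl ⟨label_second h, label_third, label_second g, label_third⟩)
  · exact Or.inr (Or.inr (Or.inl
      ⟨label_new_fst h _, label_new_fst h' _, label_third, label_second g'⟩))
  · exact Or.inr (Or.inr (Or.inr (Or.inl
      ⟨label_new_snd h _, label_new_snd h' _, label_fourth g, label_fourth g'⟩)))
  · rw [label_outer h (by omega), label_outer h' (by omega), label_outer g he.1,
      label_outer g' he.1]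
    omega

/-- The two arcs inside are merely prolonged: arc 2 is absorbed by arc 0 and arc 3 by arc 1. -/
theorem loopCount_through_parallel (h : GoodEnds p q r s n) (hE : IsThrough r s n E)
    (hJ : ∀ j ∈ J, IsOuter p q (n, true) (n + 1, true) (n + 2) k j.1 ∧
      IsOuter p q (n, true) (n + 1, true) (n + 2) k j.2) :
    loopCount (k + 4) (relabel (label p q r s n) (E ++ J)) =
      loopCount (k + 2) (relabel (label p q (n, true) (n + 1, true) (n + 2)) J) := by
  have h0 : label p q r s n r = 0 := label_third
  have h1 := label_fourth h
  have h2 := label_new_fst h false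
  have h3 := label_new_snd h false
  refine loopCount_contract (fun x => if x < 2 then x else x - 2)
    (fun x => if x < 2 then x else x + 2) ?_ ?_ ?_ ?_ ?_ ?_ ?_
  · intro x hx; split_ifs <;> omega
  · intro x hx; split_ifs <;> omega
  · intro x hx; split_ifs <;> omega
  · intro j hj
    have hj1 := label_cases h (hJ j hj).1
    have hj2 := label_cases h (hJ j hj).2
    omega
  · intro j hj
    have hj1 := label_cases h (hJ j hj).1
    have hj2 := label_cases h (hJ j hj).2
    constructor <;> split_ifs <;> omega
  · intro j hj
    rcases hE.only j hj with rfl | rfl | rfl | rfl <;> simp [h0, h1, h2, h3]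
  · have c1 := sameLoop_relabel (m := k + 4) (f := label p q r s n) (J := E ++ J)
      (hE.fst.imp (List.mem_append_left _) (List.mem_append_left _)) (by omega) (by omega)
    have c2 := sameLoop_relabel (m := k + 4) (f := label p q r s n) (J := E ++ J)
      (hE.snd.imp (List.mem_append_left _) (List.mem_append_left _)) (by omega) (by omega)
    rw [h0, h2] at c1
    rw [h1, h3] at c2
    rintro (_ | _ | _ | _ | x) hx
    · exact .refl hx
    · exact .refl hx
    · exact c1
    · exact c2
    · simpa [show ¬ x + 1 + 1 + 1 + 1 < 4 by omega] using SameLoop.refl hx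

/-- The arc joining `r` to `s` is prolonged at both of its ends, so arcs 1, 2 and 3 merge into one.
-/
theorem loopCount_through_cup (h : GoodEnds p q r s n) (hE : IsThrough r s n E)
    (hJ : ∀ j ∈ J, IsOuter p q (n, true) (n + 1, true) (n + 2) k j.1 ∧
      IsOuter p q (n, true) (n + 1, true) (n + 2) k j.2) :
    loopCount (k + 4) (relabel (label p r q s n) (E ++ J)) =
      loopCount (k + 2) (relabel (label p (n, true) q (n + 1, true) (n + 2)) J) := by
  have h0 := label_second h.swap
  have h1 := label_fourth h.swap
  have h2 := label_new_fst h.swap false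
  have h3 := label_new_snd h.swap false
  refine loopCount_contract (fun x => if x < 2 then x else if x < 4 then 1 else x - 2)
    (fun x => if x < 2 then x else x + 2) ?_ ?_ ?_ ?_ ?_ ?_ ?_
  · intro x hx; split_ifs <;> omega
  · intro x hx; split_ifs <;> omega
  · intro x hx; split_ifs <;> omega
  · intro j hj
    have hj1 := label_cases h (hJ j hj).1
    have hj2 := label_cases h (hJ j hj).2
    omega
  · intro j hj
    have hj1 := label_cases h (hJ j hj).1
    have hj2 := label_cases h (hJ j hj).2
    constructor <;> split_ifs <;> omega
  · intro j hj
    rcases hE.only j hj with rfl | rfl | rfl | rfl <;> simp [h0, h1, h2, h3]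
  · have c1 := sameLoop_relabel (m := k + 4) (f := label p r q s n) (J := E ++ J)
      (hE.fst.imp (List.mem_append_left _) (List.mem_append_left _)) (by omega) (by omega)
    have c2 := sameLoop_relabel (m := k + 4) (f := label p r q s n) (J := E ++ J)
      (hE.snd.imp (List.mem_append_left _) (List.mem_append_left _)) (by omega) (by omega)
    rw [h0, h2] at c1
    rw [h1, h3] at c2
    rintro (_ | _ | _ | _ | x) hx
    · exact .refl hx
    · exact .refl hx
    · exact c1
    · exact c2
    · simpa [show ¬ x + 1 + 1 + 1 + 1 < 4 by omega] using SameLoop.refl hx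

/-- Tying `r` to `s` turns the arcs 0 and 1 into a single arc from `p` to `q`, while the new arcs
form the other one. -/
theorem loopCount_cap_parallel (h : GoodEnds p q r s n) (hE : IsCap r s n E)
    (hJ : ∀ j ∈ J, IsOuter p q (n, true) (n + 1, true) (n + 2) k j.1 ∧
      IsOuter p q (n, true) (n + 1, true) (n + 2) k j.2) :
    loopCount (k + 4) (relabel (label p q r s n) (E ++ J)) =
      loopCount (k + 2) (relabel (label p (n, true) q (n + 1, true) (n + 2)) J) := by
  have h0 : label p q r s n r = 0 := label_third
  have h1 := label_fourth h
  have h2 := label_new_fst h false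
  have h3 := label_new_snd h false
  refine loopCount_contract (fun x => if x < 2 then 0 else if x < 4 then 1 else x - 2)
    (fun x => if x = 0 then 0 else if x = 1 then 2 else x + 2) ?_ ?_ ?_ ?_ ?_ ?_ ?_
  · intro x hx; split_ifs <;> omega
  · intro x hx; split_ifs <;> omega
  · intro x hx; split_ifs <;> omega
  · intro j hj
    have hj1 := label_cases h (hJ j hj).1
    have hj2 := label_cases h (hJ j hj).2
    omega
  · intro j hj
    have hj1 := label_cases h (hJ j hj).1
    have hj2 := label_cases h (hJ j hj).2
    constructor <;> split_ifs <;> omega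
  · intro j hj
    rcases hE.only j hj with rfl | rfl | rfl | rfl <;> simp [h0, h1, h2, h3]
  · have c1 := sameLoop_relabel (m := k + 4) (f := label p q r s n) (J := E ++ J)
      (hE.fst.imp (List.mem_append_left _) (List.mem_append_left _)) (by omega) (by omega)
    have c2 := sameLoop_relabel (m := k + 4) (f := label p q r s n) (J := E ++ J)
      (hE.snd.imp (List.mem_append_left _) (List.mem_append_left _)) (by omega) (by omega)
    rw [h0, h1] at c1
    rw [h2, h3] at c2
    rintro (_ | _ | _ | _ | x) hx
    · exact .refl hx
    · exact c1
    · exact .refl hx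
    · exact c2
    · simpa [show ¬ x + 1 + 1 + 1 + 1 < 4 by omega] using SameLoop.refl hx

/-- The inner arc from `r` to `s` is closed up by the cap and splits off as a circle, the source of
the loop value. -/
theorem loopCount_cap_cup (h : GoodEnds p q r s n) (hE : IsCap r s n E)
    (hJ : ∀ j ∈ J, IsOuter p q (n, true) (n + 1, true) (n + 2) k j.1 ∧
      IsOuter p q (n, true) (n + 1, true) (n + 2) k j.2) :
    loopCount (k + 4) (relabel (label p r q s n) (E ++ J)) =
      loopCount (k + 2) (relabel (label p (n, true) q (n + 1, true) (n + 2)) J) + 1 := by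
  have h0 := label_second h.swap
  have h1 := label_fourth h.swap
  have h2 := label_new_fst h.swap false
  have h3 := label_new_snd h.swap false
  rw [← loopCount_succ]
  -- The circle, arc 1, is given the last number `k + 2`, which no remaining join uses.
  · refine loopCount_contract
      (fun x => if x = 0 then 0 else if x = 1 then k + 2 else if x < 4 then 1 else x - 2)
      (fun x => if x = 0 then 0 else if x = 1 then 2 else if x = k + 2 then 1 else x + 2)
      ?_ ?_ ?_ ?_ ?_ ?_ ?_
    · intro x hx; split_ifs <;> omega
    · intro x hx; split_ifs <;> omega
    · rintro (_ | _ | x) hx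
      · simp
      · simp
      · by_cases hk : x = k
        · simp [hk]
        · simp [hk]
    · intro j hj
      have hj1 := label_cases h (hJ j hj).1
      have hj2 := label_cases h (hJ j hj).2
      omega
    · intro j hj
      have hj1 := label_cases h (hJ j hj).1
      have hj2 := label_cases h (hJ j hj).2
      constructor <;> split_ifs <;> omega
    · intro j hj
      rcases hE.only j hj with rfl | rfl | rfl | rfl <;> simp [h0, h1, h2, h3]
    · have c2 := sameLoop_relabel (m := k + 4) (f := label p r q s n) (J := E ++ J)
        (hE.snd.imp (List.mem_append_left _) (List.mem_append_left _)) (by omega) (by omega)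
      rw [h2, h3] at c2
      rintro (_ | _ | _ | _ | x) hx
      · exact .refl hx
      · simpa using SameLoop.refl hx
      · exact .refl hx
      · exact c2
      · simpa [show x ≠ k by omega, show ¬ x + 1 + 1 + 1 + 1 < 4 by omega] using SameLoop.refl hx
  · intro j hj
    obtain ⟨i, hi, rfl⟩ := List.mem_map.1 hj
    exact ⟨label_lt (hJ i hi).1.swap, label_lt (hJ i hi).2.swap⟩

end Smoothing

/-! ### The bracket of a tangle -/

/-- The four ends of the tangle are different, and its arcs are numbered properly. -/
structure Tangle.WellFormed (T : Tangle) : Prop where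
  ends : GoodEnds T.nw T.sw T.ne T.se T.arcs
  crossings : ∀ c ∈ T.crossings, c.u₁.1 < T.arcs ∧ c.o₁.1 < T.arcs ∧ c.u₂.1 < T.arcs ∧
    c.o₂.1 < T.arcs

/-- In the skein module, the tangle `T` is `x` times the tangle `≍` plus `y` times the tangle
`)(`. -/
def Tangle.HasSkein (T : Tangle) (x y : Laurent) : Prop :=
  ∀ (k : ℕ) (J : List (ArcEnd × ArcEnd)),
    (∀ j ∈ J, IsOuter T.nw T.sw T.ne T.se T.arcs k j.1 ∧
      IsOuter T.nw T.sw T.ne T.se T.arcs k j.2) →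
    bracketAux (T.arcs + k) J T.crossings =
      x * loopValue ^ (loopCount (k + 2) (relabel (label T.nw T.sw T.ne T.se T.arcs) J) - 1) +
      y * loopValue ^ (loopCount (k + 2) (relabel (label T.nw T.ne T.sw T.se T.arcs) J) - 1)

-- Skein coefficients after one more crossing

theorem Tangle.WellFormed.addRight {T : Tangle} (h : T.WellFormed) : T.addRight.WellFormed := by
  have := h.ends.p_lt
  have := h.ends.q_lt
  have := h.ends.r_lt
  have := h.ends.s_lt
  refine ⟨h.ends.next, ?_⟩
  intro c hc
  rcases List.mem_cons.1 hc with rfl | hc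
  · simp only [Tangle.addRight]; omega
  · have := h.crossings c hc
    simp only [Tangle.addRight]; omega

theorem Tangle.WellFormed.addBottom {T : Tangle} (h : T.WellFormed) : T.addBottom.WellFormed := by
  have := h.ends.p_lt
  have := h.ends.q_lt
  have := h.ends.r_lt
  have := h.ends.s_lt
  refine ⟨h.ends.swap.next.swap, ?_⟩
  intro c hc
  rcases List.mem_cons.1 hc with rfl | hc
  · simp only [Tangle.addBottom]; omega
  · have := h.crossings c hc
    simp only [Tangle.addBottom]; omega

/-- Seen from the inner tangle, the two arcs of the new crossing are outer arcs, so `k` grows to `k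
+ 2`. -/
theorem isOuter_joins {p q r s : ArcEnd} {n k : ℕ} {J E : List (ArcEnd × ArcEnd)}
    (hE : ∀ j ∈ E, IsOuter p q r s n (k + 2) j.1 ∧ IsOuter p q r s n (k + 2) j.2)
    (hJ : ∀ j ∈ J, IsOuter p q (n, true) (n + 1, true) (n + 2) k j.1 ∧
      IsOuter p q (n, true) (n + 1, true) (n + 2) k j.2) :
    ∀ j ∈ E ++ J, IsOuter p q r s n (k + 2) j.1 ∧ IsOuter p q r s n (k + 2) j.2 := by
  have key : ∀ e, IsOuter p q (n, true) (n + 1, true) (n + 2) k e →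
      IsOuter p q r s n (k + 2) e := by
    rintro e ((rfl | rfl | rfl | rfl) | he)
    · simp [IsOuter]
    · simp [IsOuter]
    · right; simp
    · right; simp
    · right; omega
  intro j hj
  rcases List.mem_append.1 hj with hj | hj
  · exact hE j hj
  · exact ⟨key _ (hJ j hj).1, key _ (hJ j hj).2⟩

theorem loopValue_pow_sub_one {c d : ℕ} (h : c = d + 1) (hd : 0 < d) :
    loopValue ^ (c - 1) = loopValue * loopValue ^ (d - 1) := by
  rw [← pow_succ']; congr 1; omega

/-- The new crossing heads the list, so it is smoothed first and its joins become part of the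
outside of `T`. Its A-smoothing continues both strands, the other one caps them. -/
theorem Tangle.HasSkein.addRight {T : Tangle} (hT : T.WellFormed) {x y : Laurent}
    (h : T.HasSkein x y) :
    T.addRight.HasSkein (Apow 1 * x) (Apow (-1) * x - Apow (-3) * y) := by
  intro k J hJ
  have h1 : IsThrough T.ne T.se T.arcs
      [(T.se, (T.arcs + 1, false)), ((T.arcs, false), T.ne)] :=
    ⟨by simp, by simp, by simp⟩
  have h2 : IsCap T.ne T.se T.arcs
      [(T.se, T.ne), ((T.arcs + 1, false), (T.arcs, false))] :=
    ⟨by simp, by simp, by simp⟩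
  have hpos := loopCount_pos (m := k + 2) (by omega)
    (relabel (label T.nw (T.arcs, true) T.sw (T.arcs + 1, true) (T.arcs + 2)) J)
  have e1 := h (k + 2) _ (isOuter_joins (E := [(T.se, (T.arcs + 1, false)),
    ((T.arcs, false), T.ne)]) (by simp [IsOuter]) hJ)
  have e2 := h (k + 2) _ (isOuter_joins (E := [(T.se, T.ne),
    ((T.arcs + 1, false), (T.arcs, false))]) (by simp [IsOuter]) hJ)
  rw [loopCount_through_parallel hT.ends h1 hJ, loopCount_through_cup hT.ends h1 hJ] at e1
  rw [loopCount_cap_parallel hT.ends h2 hJ,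
    loopValue_pow_sub_one (loopCount_cap_cup hT.ends h2 hJ) hpos] at e2
  have e3 : T.addRight.arcs + k = T.arcs + (k + 2) := by simp only [Tangle.addRight]; omega
  rw [e3]
  simp only [Tangle.addRight, bracketAux]
  simp only [List.cons_append, List.nil_append] at e1 e2
  rw [e1, e2]
  have a1 : Apow (-1) * Apow 2 = Apow 1 := by rw [← LaurentPolynomial.T_add]; norm_num
  have a2 : Apow (-1) * Apow (-2) = Apow (-3) := by rw [← LaurentPolynomial.T_add]; norm_num
  -- On )( the smoothings contribute A + A⁻¹ δ = -A⁻³.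
  have a3 : Apow (-1) * loopValue = -Apow 1 - Apow (-3) := by rw [loopValue, ← a1, ← a2]; ring
  linear_combination (y * loopValue ^ (loopCount (k + 2) (relabel
    (label T.nw (T.arcs, true) T.sw (T.arcs + 1, true) (T.arcs + 2)) J) - 1)) * a3

/-- The mirror case in the diagonal: now the A-smoothing is the cap, and ≍ acquires the factor A δ +
A⁻¹ = -A³. -/
theorem Tangle.HasSkein.addBottom {T : Tangle} (hT : T.WellFormed) {x y : Laurent}
    (h : T.HasSkein x y) :
    T.addBottom.HasSkein (-Apow 3 * x + Apow 1 * y) (Apow (-1) * y) := by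
  intro k J hJ
  have hJ' : ∀ j ∈ J, IsOuter T.nw T.ne (T.arcs, true) (T.arcs + 1, true) (T.arcs + 2) k j.1 ∧
      IsOuter T.nw T.ne (T.arcs, true) (T.arcs + 1, true) (T.arcs + 2) k j.2 :=
    fun j hj => ⟨(hJ j hj).1.swap, (hJ j hj).2.swap⟩
  have h1 : IsThrough T.sw T.se T.arcs
      [((T.arcs, false), T.sw), ((T.arcs + 1, false), T.se)] :=
    ⟨by simp, by simp, by simp⟩
  have h2 : IsCap T.sw T.se T.arcs
      [((T.arcs, false), (T.arcs + 1, false)), (T.se, T.sw)] :=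
    ⟨by simp, by simp, by simp⟩
  have hpos := loopCount_pos (m := k + 2) (by omega)
    (relabel (label T.nw (T.arcs, true) T.ne (T.arcs + 1, true) (T.arcs + 2)) J)
  have key := fun (E : List (ArcEnd × ArcEnd)) hE => h (k + 2) _ fun j hj =>
    have := isOuter_joins (p := T.nw) (q := T.ne) (r := T.sw) (s := T.se) (E := E) hE hJ' j hj
    ⟨this.1.swap, this.2.swap⟩
  have e1 := key [((T.arcs, false), T.sw), ((T.arcs + 1, false), T.se)] (by simp [IsOuter])
  have e2 := key [((T.arcs, false), (T.arcs + 1, false)), (T.se, T.sw)] (by simp [IsOuter])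
  rw [loopCount_through_parallel hT.ends.swap h1 hJ',
    loopCount_through_cup hT.ends.swap h1 hJ'] at e1
  rw [loopCount_cap_parallel hT.ends.swap h2 hJ',
    loopValue_pow_sub_one (loopCount_cap_cup hT.ends.swap h2 hJ') hpos] at e2
  have e3 : T.addBottom.arcs + k = T.arcs + (k + 2) := by simp only [Tangle.addBottom]; omega
  rw [e3]
  simp only [Tangle.addBottom, bracketAux]
  simp only [List.cons_append, List.nil_append] at e1 e2
  rw [e1, e2]
  have a1 : Apow 1 * Apow 2 = Apow 3 := by rw [← LaurentPolynomial.T_add]; norm_num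
  have a2 : Apow 1 * Apow (-2) = Apow (-1) := by rw [← LaurentPolynomial.T_add]; norm_num
  have a3 : Apow 1 * loopValue = -Apow 3 - Apow (-1) := by rw [loopValue, ← a1, ← a2]; ring
  linear_combination (x * loopValue ^ (loopCount (k + 2) (relabel
    (label T.nw (T.arcs, true) T.ne (T.arcs + 1, true) (T.arcs + 2)) J) - 1)) * a3

theorem Tangle.WellFormed.zero : Tangle.zero.WellFormed :=
  ⟨by constructor <;> simp [Tangle.zero], by simp [Tangle.zero]⟩

theorem Tangle.WellFormed.infinity : Tangle.infinity.WellFormed :=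
  ⟨by constructor <;> simp [Tangle.infinity], by simp [Tangle.infinity]⟩

theorem Tangle.HasSkein.zero : Tangle.zero.HasSkein 1 0 := by
  intro k J hJ
  have key : ∀ e, IsOuter Tangle.zero.nw Tangle.zero.sw Tangle.zero.ne Tangle.zero.se
      Tangle.zero.arcs k e → label Tangle.zero.nw Tangle.zero.sw Tangle.zero.ne Tangle.zero.se
      Tangle.zero.arcs e = e.1 := by
    rintro e ((rfl | rfl | rfl | rfl) | he)
    · exact label_first
    · exact label_second Tangle.WellFormed.zero.ends
    · exact label_third
    · exact label_fourth Tangle.WellFormed.zero.ends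
    · rw [label_outer Tangle.WellFormed.zero.ends he.1]
      exact Nat.sub_add_cancel he.1
  rw [loopCount_relabel_of_eq fun j hj => ⟨key _ (hJ j hj).1, key _ (hJ j hj).2⟩]
  simp [Tangle.zero, bracketAux, add_comm]

theorem Tangle.HasSkein.infinity : Tangle.infinity.HasSkein 0 1 := by
  intro k J hJ
  have g := Tangle.WellFormed.infinity.ends.swap
  have key : ∀ e, IsOuter Tangle.infinity.nw Tangle.infinity.sw Tangle.infinity.ne
      Tangle.infinity.se Tangle.infinity.arcs k e → label Tangle.infinity.nw Tangle.infinity.ne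
      Tangle.infinity.sw Tangle.infinity.se Tangle.infinity.arcs e = e.1 := by
    rintro e ((rfl | rfl | rfl | rfl) | he)
    · exact label_first
    · exact label_third
    · exact label_second g
    · exact label_fourth g
    · rw [label_outer g he.1]
      exact Nat.sub_add_cancel he.1
  rw [loopCount_relabel_of_eq fun j hj => ⟨key _ (hJ j hj).1, key _ (hJ j hj).2⟩]
  simp [Tangle.infinity, bracketAux, add_comm]

/-- The bracket of the denominator closure. -/
theorem Tangle.HasSkein.bracket_denominator {T : Tangle} (hT : T.WellFormed) {x y : Laurent}
    (h : T.HasSkein x y) : T.denominator.bracket = x + loopValue * y := by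
  have e := h 0 [(T.nw, T.sw), (T.ne, T.se)] (by simp [IsOuter])
  -- Closing ≍ gives one circle; closing )( below gives two.
  have l1 : loopCount 2 (relabel (label T.nw T.sw T.ne T.se T.arcs)
      [(T.nw, T.sw), (T.ne, T.se)]) = 1 := by
    have : Subsingleton (Quot fun u v : Fin 2 =>
        ∃ j ∈ relabel (label T.nw T.sw T.ne T.se T.arcs) [(T.nw, T.sw), (T.ne, T.se)],
          j.1.1 = (u : ℕ) ∧ j.2.1 = (v : ℕ)) := by
      have key : SameLoop 2 (relabel (label T.nw T.sw T.ne T.se T.arcs)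
          [(T.nw, T.sw), (T.ne, T.se)]) 0 1 := by
        have := sameLoop_relabel (m := 2) (f := label T.nw T.sw T.ne T.se T.arcs)
          (J := [(T.nw, T.sw), (T.ne, T.se)]) (a := T.nw) (b := T.sw) (by simp)
          (by simp [label_first]) (by simp [label_second hT.ends])
        rwa [label_first, label_second hT.ends] at this
      refine ⟨?_⟩
      rintro ⟨u⟩ ⟨v⟩
      fin_cases u <;> fin_cases v
      · rfl
      · exact key.2.2
      · exact key.2.2.symm
      · rfl
    have := loopCount_pos (m := 2) (by omega)
      (relabel (label T.nw T.sw T.ne T.se T.arcs) [(T.nw, T.sw), (T.ne, T.se)])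
    have := Finite.card_le_one_iff_subsingleton.2 ‹Subsingleton (Quot _)›
    unfold loopCount at *
    omega
  have l2 : loopCount 2 (relabel (label T.nw T.ne T.sw T.se T.arcs)
      [(T.nw, T.sw), (T.ne, T.se)]) = 2 := by
    have : loopCount 2 (relabel (label T.nw T.ne T.sw T.se T.arcs)
      [(T.nw, T.sw), (T.ne, T.se)]) = Nat.card (Fin 2) := by
      refine Nat.card_congr ⟨Quot.lift id ?_, Quot.mk _, ?_, fun _ => rfl⟩
      · rintro u v ⟨j, hj, hu, hv⟩
        have : j = ((0, false), (0, false)) ∨ j = ((1, false), (1, false)) := by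
          simpa [relabel, label_first, label_third, label_second hT.ends.swap,
            label_fourth hT.ends.swap] using hj
        rcases this with rfl | rfl <;> exact Fin.ext (hu.symm.trans hv)
      · rintro ⟨u⟩
        rfl
    simpa using this
  rw [l1, l2] at e
  have : T.denominator.bracket = bracketAux (T.arcs + 0) [(T.nw, T.sw), (T.ne, T.se)] T.crossings :=
    rfl
  rw [this, e]
  ring


/-! ### The bracket of a rational tangle -/

/-- The brackets of the parents after a step to the left. -/
noncomputable def stepLeft (v : Laurent × Laurent) : Laurent × Laurent := (v.1, fareyBracket v.1 v.2)

/-- The brackets of the parents after a step to the right. -/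
noncomputable def stepRight (v : Laurent × Laurent) : Laurent × Laurent :=
  (fareyBracket v.1 v.2, v.2)

mutual
/-- The bracket at `[0, a₁, …, aₙ]` if the brackets at `0` and `∞` are given. -/
noncomputable def fractionBracket : List ℕ → Laurent × Laurent → Laurent
  | [], v => v.1
  | a :: l, v => fractionBracketHor l (stepLeft^[a] v)
/-- The bracket at `a₁ + [0, a₂, …, aₙ]` if the brackets at `0` and `∞` are given. -/
noncomputable def fractionBracketHor : List ℕ → Laurent × Laurent → Laurent
  | [], v => v.2
  | a :: l, v => fractionBracket l (stepRight^[a] v)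
end

theorem negACubedPow_add (j k : ℤ) :
    negACubedPow (j + k) = negACubedPow j * negACubedPow k := by
  simp [negACubedPow, zpow_add]

theorem negACubedPow_zero : negACubedPow 0 = 1 := by simp [negACubedPow]

theorem negACubedPow_one : negACubedPow 1 = -Apow 3 := by simp [negACubedPow, negACubed]

theorem negACubedPow_neg_one : negACubedPow (-1) = -Apow (-3) := by
  simp [negACubedPow, negACubed]

theorem negACubedPow_two : negACubedPow 2 = Apow 6 := by
  rw [show (2 : ℤ) = 1 + 1 by rfl, negACubedPow_add, negACubedPow_one, neg_mul_neg,
    ← LaurentPolynomial.T_add]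
  norm_num

theorem Apow_mul {i j k : ℤ} (h : i + j = k) : Apow i * Apow j = Apow k := by
  rw [← LaurentPolynomial.T_add, h]

/-- Adjointness, iterated. The crossing added last corresponds to the step taken first, hence the
two different unfoldings of the iterates. -/
theorem Tangle.HasSkein.iterate_addBottom {T : Tangle} (hT : T.WellFormed) {x y : Laurent}
    (h : T.HasSkein x y) (a : ℕ) :
    (Tangle.addBottom^[a] T).WellFormed ∧ ∃ x' y', (Tangle.addBottom^[a] T).HasSkein x' y' ∧
      ∀ v : Laurent × Laurent, x' * v.1 + y' * Apow (-6) * v.2 =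
        negACubedPow a * (x * (stepLeft^[a] v).1 + y * Apow (-6) * (stepLeft^[a] v).2) := by
  induction a with
  | zero => exact ⟨hT, x, y, h, fun v => by simp [negACubedPow_zero]⟩
  | succ a ih =>
    obtain ⟨hw, x', y', hs, hv⟩ := ih
    rw [Function.iterate_succ_apply']
    refine ⟨hw.addBottom, _, _, hs.addBottom hw, fun v => ?_⟩
    rw [Function.iterate_succ_apply, Nat.cast_succ, add_comm (a : ℤ) 1, negACubedPow_add,
      mul_assoc (negACubedPow 1),
      ← hv (stepLeft v), negACubedPow_one]
    simp only [stepLeft, fareyBracket]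
    have e1 : Apow 3 * Apow (-6) = Apow (-3) := Apow_mul rfl
    have e2 : Apow (-3) * Apow 4 = Apow 1 := Apow_mul rfl
    have e3 : Apow (-3) * Apow (-4) = Apow (-7) := Apow_mul rfl
    have e4 : Apow (-1) * Apow (-6) = Apow (-7) := Apow_mul rfl
    linear_combination y' * v.2 * e4 - y' * v.1 * e2 - y' * v.2 * e3 -
      y' * (Apow 4 * v.1 + Apow (-4) * v.2) * e1

theorem Tangle.HasSkein.iterate_addRight {T : Tangle} (hT : T.WellFormed) {x y : Laurent}
    (h : T.HasSkein x y) (a : ℕ) :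
    (Tangle.addRight^[a] T).WellFormed ∧ ∃ x' y', (Tangle.addRight^[a] T).HasSkein x' y' ∧
      ∀ v : Laurent × Laurent, x' * v.1 + y' * Apow (-6) * v.2 =
        negACubedPow (-a) * (x * (stepRight^[a] v).1 + y * Apow (-6) * (stepRight^[a] v).2) := by
  induction a with
  | zero => exact ⟨hT, x, y, h, fun v => by simp [negACubedPow_zero]⟩
  | succ a ih =>
    obtain ⟨hw, x', y', hs, hv⟩ := ih
    rw [Function.iterate_succ_apply']
    refine ⟨hw.addRight, _, _, hs.addRight hw, fun v => ?_⟩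
    rw [Function.iterate_succ_apply, Nat.cast_succ, neg_add_rev, negACubedPow_add,
      mul_assoc (negACubedPow (-1)),
      ← hv (stepRight v), negACubedPow_neg_one]
    simp only [stepRight, fareyBracket]
    have e1 : Apow (-1) * Apow (-6) = Apow (-7) := Apow_mul rfl
    have e2 : Apow (-3) * Apow 4 = Apow 1 := Apow_mul rfl
    have e3 : Apow (-3) * Apow (-4) = Apow (-7) := Apow_mul rfl
    linear_combination x' * v.2 * e1 - x' * v.1 * e2 - x' * v.2 * e3

/-- The skein coefficients of a rational tangle are dual to the Farey recursion. -/
theorem rationalTangle_hasSkein (l : List ℕ) :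
    ((rationalTangle l).WellFormed ∧ ∃ x y, (rationalTangle l).HasSkein x y ∧
      ∀ v, fractionBracket l v = negACubedPow (altSum l) * (x * v.1 + y * Apow (-6) * v.2) *
        if Even l.length then 1 else Apow 6) ∧
    ((rationalTangleHor l).WellFormed ∧ ∃ x y, (rationalTangleHor l).HasSkein x y ∧
      ∀ v, fractionBracketHor l v =
        negACubedPow (-altSum l) * (x * v.1 + y * Apow (-6) * v.2) *
          if Even l.length then Apow 6 else 1) := by
  induction l with
  | nil =>
    have e : Apow (-6) * Apow 6 = 1 := by rw [Apow_mul (k := 0) rfl]; simp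
    refine ⟨⟨.zero, 1, 0, .zero, fun v => ?_⟩, ⟨.infinity, 0, 1, .infinity, fun v => ?_⟩⟩
    · simp [fractionBracket, altSum, negACubedPow_zero]
    · simp only [fractionBracketHor, altSum, neg_zero, negACubedPow_zero, List.length_nil,
        Even.zero, if_true]
      linear_combination -v.2 * e
  | cons a l ih =>
    obtain ⟨⟨hw, x, y, hs, hv⟩, ⟨hw', x', y', hs', hv'⟩⟩ := ih
    obtain ⟨hu, z, w, ht, hz⟩ := hs.iterate_addRight hw a
    obtain ⟨hu', z', w', ht', hz'⟩ := hs'.iterate_addBottom hw' a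
    refine ⟨⟨hu', z', w', ht', fun v => ?_⟩, ⟨hu, z, w, ht, fun v => ?_⟩⟩
    · have : -altSum l = altSum (a :: l) + a := by simp [altSum]
      rw [hz', fractionBracket, hv', this, negACubedPow_add]
      simp only [List.length_cons, Nat.even_add_one]
      split_ifs <;> first | contradiction | ring
    · have : altSum l = -altSum (a :: l) + (-a) := by simp [altSum]
      rw [hz, fractionBracketHor, hv, this, negACubedPow_add]
      simp only [List.length_cons, Nat.even_add_one]
      split_ifs <;> first | contradiction | ring

/-- The closure x + δ y is the pairing with (1, A⁶ δ), and the correction A⁶ for odd length equals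
(-A³)². -/
theorem negACubedPow_weight_mul_bracket (l : List ℕ) :
    negACubedPow (weight l) * (rationalLink l).bracket =
      fractionBracket l (1, -Apow 4 - Apow 8) := by
  obtain ⟨hw, x, y, hs, hv⟩ := (rationalTangle_hasSkein l).1
  have e1 : Apow (-6) * Apow 4 = Apow (-2) := Apow_mul rfl
  have e2 : Apow (-6) * Apow 8 = Apow 2 := Apow_mul rfl
  have hb : (rationalLink l).bracket = x * 1 + y * Apow (-6) * (-Apow 4 - Apow 8) := by
    rw [rationalLink, hs.bracket_denominator hw, loopValue]
    linear_combination y * e1 + y * e2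
  rw [hv, hb, weight]
  split_ifs
  · ring
  · rw [negACubedPow_add, negACubedPow_two]
    ring

/-! ### Numerators and denominators -/

/-- Numerator and denominator of `[0, a₁, …, aₙ]`. -/
def contFracPair : List ℕ → ℕ × ℕ
  | [] => (0, 1)
  | a :: l => ((contFracPair l).2, a * (contFracPair l).2 + (contFracPair l).1)

theorem contFracPair_snd_pos {l : List ℕ} (hl : ∀ x ∈ l, 0 < x) : 0 < (contFracPair l).2 := by
  induction l with
  | nil => exact Nat.one_pos
  | cons a l ih =>
    have := ih fun x hx => hl x (List.mem_cons_of_mem _ hx)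
    have := Nat.mul_pos (hl a List.mem_cons_self) this
    simp only [contFracPair]
    omega

theorem contFracPair_fst_pos {l : List ℕ} (hl : ∀ x ∈ l, 0 < x) (h : l ≠ []) :
    0 < (contFracPair l).1 := by
  cases l with
  | nil => contradiction
  | cons a l => exact contFracPair_snd_pos fun x hx => hl x (List.mem_cons_of_mem _ hx)

theorem contFracPair_coprime (l : List ℕ) : (contFracPair l).1.Coprime (contFracPair l).2 := by
  induction l with
  | nil => exact Nat.coprime_one_right 0
  | cons a l ih =>
    simp only [contFracPair]
    rw [Nat.coprime_mul_right_add_right]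
    exact ih.symm

theorem contFrac_eq {l : List ℕ} (hl : ∀ x ∈ l, 0 < x) :
    contFrac l = (contFracPair l).1 / (contFracPair l).2 := by
  induction l with
  | nil => simp [contFrac, contFracPair]
  | cons a l ih =>
    have hl' : ∀ x ∈ l, 0 < x := fun x hx => hl x (List.mem_cons_of_mem _ hx)
    have h := contFracPair_snd_pos hl'
    have h' := contFracPair_snd_pos hl
    have : ((contFracPair l).2 : ℚ) ≠ 0 := by positivity
    simp only [contFrac, contFracPair] at h' ⊢
    rw [ih hl']
    have : ((a * (contFracPair l).2 + (contFracPair l).1 : ℕ) : ℚ) ≠ 0 := by positivity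
    push_cast at *
    field_simp

theorem contFrac_den {l : List ℕ} (hl : ∀ x ∈ l, 0 < x) :
    (contFrac l).den = (contFracPair l).2 := by
  have h := Rat.den_div_eq_of_coprime (a := (contFracPair l).1) (b := (contFracPair l).2)
    (by exact_mod_cast contFracPair_snd_pos hl) (by simpa using contFracPair_coprime l)
  rw [contFrac_eq hl]
  simp only [Int.cast_natCast] at h
  exact Int.natCast_inj.1 h

/-! ### Descent in the Stern–Brocot tree -/

/-- The bracket at the fraction `u / w`, found by at most `n` steps of the subtractive Euclidean
algorithm, if the brackets at `0` and `∞` are given. -/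
noncomputable def descentBracket : ℕ → ℕ → ℕ → Laurent × Laurent → Laurent
  | 0, _, _, v => fareyBracket v.1 v.2
  | n + 1, u, w, v =>
      if u < w then descentBracket n u (w - u) (stepLeft v)
      else if w < u then descentBracket n (u - w) w (stepRight v)
      else fareyBracket v.1 v.2

/-- In the interval from p/q to r/s, the number α has the relative coordinate u/w, with the mediant
at u = w. Halving the interval is thus a subtractive Euclidean step on (u, w). -/
theorem fareyBracket_sternBrocotWord {α : ℚ} (n : ℕ) : ∀ {u w p q r s : ℕ} (l : List Letter),
    α = (p * w + r * u) / (q * w + s * u) → 0 < u → 0 < w → 0 < q → 0 < s →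
    r * q = p * s + 1 →
    fareyBracket (parentBrackets (sternBrocotWord α n p q r s l)).1
      (parentBrackets (sternBrocotWord α n p q r s l)).2 =
      descentBracket n u w (parentBrackets l) := by
  induction n with
  | zero => intros; rfl
  | succ n ih =>
    intro u w p q r s l hα hu hw hq hs hd
    have hd' : (r * q : ℚ) = p * s + 1 := by exact_mod_cast hd
    have h1 : (0 : ℚ) < q * w + s * u := by positivity
    have h2 : (0 : ℚ) < q + s := by positivity
    have lt1 : α < ((p + r : ℕ) : ℚ) / ((q + s : ℕ) : ℚ) ↔ u < w := by
      rw [hα, ← Nat.cast_lt (α := ℚ)]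
      push_cast
      rw [div_lt_div_iff₀ h1 h2, ← sub_pos, ← sub_pos (b := (u : ℚ))]
      -- The difference of cross products is (w - u)(r q - p s), and r q - p s = 1.
      have : ((p + r) * (q * w + s * u) - (p * w + r * u) * (q + s) : ℚ) = w - u := by
        linear_combination (w - u : ℚ) * hd'
      rw [this]
    have lt2 : ((p + r : ℕ) : ℚ) / ((q + s : ℕ) : ℚ) < α ↔ w < u := by
      rw [hα, ← Nat.cast_lt (α := ℚ)]
      push_cast
      rw [div_lt_div_iff₀ h2 h1, ← sub_pos, ← sub_pos (b := (w : ℚ))]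
      have : ((p * w + r * u) * (q + s) - (p + r) * (q * w + s * u) : ℚ) = u - w := by
        linear_combination (u - w : ℚ) * hd'
      rw [this]
    simp only [sternBrocotWord, descentBracket, lt1, lt2]
    split_ifs with c1 c2
    · rw [ih (u := u) (w := w - u) _ _ hu (by omega) hq (by omega) (by linarith)]
      · rfl
      · rw [hα, Nat.cast_sub c1.le]
        push_cast
        congr 1 <;> ring
    · rw [ih (u := u - w) (w := w) _ _ (by omega) hw (by omega) hs (by linarith)]
      · rfl
      · rw [hα, Nat.cast_sub c2.le]
        push_cast
        congr 1 <;> ring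
    · rfl

-- Descent along a continued fraction

/-- The descent stops after `a - 1` steps and takes the Farey sum; this is the entry that one more
step would write. -/
theorem descentBracket_one_left {a n : ℕ} (ha : 0 < a) (hn : a ≤ n + 1) (v : Laurent × Laurent) :
    descentBracket n 1 a v = (stepLeft^[a] v).2 := by
  induction a, ha using Nat.le_induction generalizing n v with
  | base => cases n <;> simp [descentBracket, stepLeft]
  | succ a ha ih =>
    obtain ⟨n, rfl⟩ : ∃ m, n = m + 1 := ⟨n - 1, by omega⟩
    rw [descentBracket, if_pos (by omega), Nat.add_sub_cancel, ih (by omega),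
      Function.iterate_succ_apply]

theorem descentBracket_one_right {a n : ℕ} (ha : 0 < a) (hn : a ≤ n + 1)
    (v : Laurent × Laurent) : descentBracket n a 1 v = (stepRight^[a] v).1 := by
  induction a, ha using Nat.le_induction generalizing n v with
  | base => cases n <;> simp [descentBracket, stepRight]
  | succ a ha ih =>
    obtain ⟨n, rfl⟩ : ∃ m, n = m + 1 := ⟨n - 1, by omega⟩
    rw [descentBracket, if_neg (by omega), if_pos (by omega), Nat.add_sub_cancel, ih (by omega),
      Function.iterate_succ_apply]

theorem descentBracket_left {P Q : ℕ} (hP : 0 < P) (a n : ℕ) (v : Laurent × Laurent) :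
    descentBracket (n + a) Q (a * Q + P) v = descentBracket n Q P (stepLeft^[a] v) := by
  induction a generalizing v with
  | zero => simp
  | succ a ih =>
    rw [← add_assoc, descentBracket, if_pos (by nlinarith), Function.iterate_succ_apply, ← ih]
    congr 1
    rw [Nat.succ_mul]
    omega

theorem descentBracket_right {P Q : ℕ} (hP : 0 < P) (a n : ℕ) (v : Laurent × Laurent) :
    descentBracket (n + a) (a * Q + P) Q v = descentBracket n P Q (stepRight^[a] v) := by
  induction a generalizing v with
  | zero => simp
  | succ a ih =>
    have : Q < (a + 1) * Q + P := by nlinarith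
    rw [← add_assoc, descentBracket, if_neg (by omega), if_pos this, Function.iterate_succ_apply,
      ← ih]
    congr 1
    rw [Nat.succ_mul]
    omega

/-- Each entry of the expansion is one run of equal Euclidean steps. A last entry 1 needs no special
treatment, so both expansions of α are covered. -/
theorem descentBracket_contFracPair {l : List ℕ} (hl : ∀ x ∈ l, 0 < x) (h : l ≠ []) :
    ∀ (n : ℕ) (v : Laurent × Laurent), (contFracPair l).1 ≤ n + 1 → (contFracPair l).2 ≤ n + 1 →
      descentBracket n (contFracPair l).1 (contFracPair l).2 v = fractionBracket l v ∧
      descentBracket n (contFracPair l).2 (contFracPair l).1 v = fractionBracketHor l v := by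
  induction l with
  | nil => contradiction
  | cons a l ih =>
    intro n v h1 h2
    have ha : 0 < a := hl a List.mem_cons_self
    have hl' : ∀ x ∈ l, 0 < x := fun x hx => hl x (List.mem_cons_of_mem _ hx)
    rcases eq_or_ne l [] with rfl | hne
    · simp only [contFracPair, mul_one, add_zero] at h2 ⊢
      exact ⟨descentBracket_one_left ha h2 v, descentBracket_one_right ha h2 v⟩
    · have hP := contFracPair_fst_pos hl' hne
      have hQ := contFracPair_snd_pos hl'
      simp only [contFracPair] at h1 h2 ⊢
      generalize (contFracPair l).1 = P at *
      generalize (contFracPair l).2 = Q at *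
      -- This is (a - 1)(Q - 1) ≥ 0; it ensures that the step budget left after `a` steps suffices.
      have hb : a + Q ≤ a * Q + 1 := by nlinarith
      obtain ⟨m, rfl⟩ : ∃ m, n = m + a := ⟨n - a, by omega⟩
      have ih' := fun v => ih hl' hne m v (by nlinarith) (by omega)
      rw [descentBracket_left hP, descentBracket_right hP]
      exact ⟨(ih' _).2, (ih' _).1⟩

theorem fareyBracket_wordOf {l : List ℕ} (hl : ∀ x ∈ l, 0 < x) (h0 : 0 < contFrac l)
    (h1 : contFrac l < 1) :
    fareyBracket (parentBrackets (wordOf (contFrac l))).1 (parentBrackets (wordOf (contFrac l))).2 =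
      fractionBracket l (1, -Apow 4 - Apow 8) := by
  have hne : l ≠ [] := by
    rintro rfl
    exact lt_irrefl _ h0
  have hP := contFracPair_fst_pos hl hne
  have hQ := contFracPair_snd_pos hl
  have hQ' : (0 : ℚ) < (contFracPair l).2 := by exact_mod_cast hQ
  have hlt : (contFracPair l).1 < (contFracPair l).2 := by
    rw [contFrac_eq hl, div_lt_one hQ'] at h1
    exact_mod_cast h1
  rw [wordOf, fareyBracket_sternBrocotWord (u := (contFracPair l).1)
    (w := (contFracPair l).2 - (contFracPair l).1) _ _ _ hP (by omega) one_pos one_pos (by norm_num),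
    contFrac_den hl]
  -- The tree starts in [0, 1] and the continued fraction in (0, ∞): one extra left step, forced by
  -- α < 1, connects them.
  · rw [← (descentBracket_contFracPair hl hne ((contFracPair l).2 + 1) _ (by omega) (by omega)).1,
      descentBracket, if_pos hlt]
    congr 1
    have e1 : Apow (-4) * Apow 4 = 1 := by rw [Apow_mul (k := 0) rfl]; simp
    have e2 : Apow (-4) * Apow 8 = Apow 4 := Apow_mul rfl
    simp only [parentBrackets, stepLeft, fareyBracket, Prod.mk.injEq, true_and]
    linear_combination -e1 - e2
  · rw [contFrac_eq hl, Nat.cast_sub hlt.le]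
    simp

/-! ### The word of a zigzag frieze -/

/-- The first generated number on a line lies two columns beyond the zigzag; before that the initial
one persists. -/
theorem sweep_eq_one {w : List Letter} {t k : ℕ} (h : (t : ℤ) - w.length < zigzagColumn w k + 2) :
    sweep w t k = 1 := by
  induction t with
  | zero => rfl
  | succ t ih =>
    push_cast at h
    rw [sweep, if_neg, ih (by omega)]
    rintro ⟨_, _, h3, m, hm⟩
    omega

/-- Positivity makes the first number next to the zigzag strictly larger than 1. -/
theorem sweep_pos (w : List Letter) (t k : ℕ) : 0 < sweep w t k := by
  induction t generalizing k with
  | zero => exact one_pos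
  | succ t ih =>
    have := ih (k - 1)
    have := ih k
    have := ih (k + 1)
    rw [sweep]
    split_ifs <;> positivity

theorem zigzagColumn_swapLetters (w : List Letter) (k : ℕ) :
    zigzagColumn (swapLetters w) k = -zigzagColumn w k := by
  have key : ∀ u : List Letter,
      ((swapLetters u).map Letter.step).sum = -(u.map Letter.step).sum := by
    intro u
    induction u with
    | nil => rfl
    | cons x u ih =>
      rw [swapLetters] at ih ⊢
      cases x <;> simp only [List.map_cons, List.sum_cons, Letter.step, ih] <;> omega
  rw [zigzagColumn, zigzagColumn, ← key, swapLetters, swapLetters]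
  simp only [List.map_take]

theorem zigzagColumn_succ {w : List Letter} {k : ℕ} (h : k < w.length) :
    zigzagColumn w (k + 2) = zigzagColumn w (k + 1) + (w[k]).step := by
  rw [zigzagColumn, zigzagColumn, show k + 2 - 1 = k + 1 from rfl, Nat.add_sub_cancel,
    List.take_succ_eq_append_getElem h, List.map_append, List.sum_append]
  simp

theorem zigzagColumn_le (w : List Letter) (k : ℕ) : zigzagColumn w k ≤ w.length := by
  have key : ∀ u : List Letter, (u.map Letter.step).sum ≤ u.length := by
    intro u
    induction u with
    | nil => simp
    | cons x u ih => cases x <;> simp [Letter.step] <;> omega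
  refine (key _).trans ?_
  simp

/-- At a letter `L` the lower left neighbour is on the zigzag. At `R` it is the first number
generated to the left, (1 + 1 · c) / 1 with c > 0, so it is not 1. -/
theorem readWord_zigzagFrieze (w : List Letter) (n k : ℕ) (h : n + k = w.length) :
    readWord (zigzagFrieze w) n (k + 1) (zigzagColumn w (k + 1)) = w.drop k := by
  induction n generalizing k with
  | zero => simp [readWord, ← h]
  | succ n ih =>
    have hk : k < w.length := by omega
    have hc := zigzagColumn_succ hk
    have ih' := ih (k + 1) (by omega)
    rw [readWord, List.drop_eq_getElem_cons hk, ← ih']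
    rw [show k + 1 + 1 = k + 2 from rfl]
    have hle := zigzagColumn_le w (k + 1)
    have hge := zigzagColumn_le (swapLetters w) (k + 1)
    have hs := zigzagColumn_swapLetters w (k + 1)
    have hlen : (swapLetters w).length = w.length := by simp [swapLetters]
    rw [hs, hlen] at hge
    generalize zigzagColumn w (k + 1) = x at *
    cases hw : w[k] with
    | L =>
      rw [hw] at hc
      simp only [Letter.step] at hc
      rw [if_pos, hc, ← sub_eq_add_neg]
      simp only [zigzagFrieze]
      rw [if_pos (by omega)]
      apply sweep_eq_one
      omega
    | R =>
      rw [hw] at hc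
      simp only [Letter.step] at hc
      rw [if_neg, hc]
      simp only [zigzagFrieze]
      have hs' := zigzagColumn_swapLetters w (k + 2)
      obtain ⟨t, ht⟩ : ∃ t : ℕ, (t : ℤ) = w.length - x := ⟨(w.length - x).toNat, by omega⟩
      have e : (-(x - 1) + (w.length : ℤ)).toNat = t + 1 := by omega
      -- This neighbour lies left of the zigzag, so it comes from the reflected sweep; the two
      -- numbers on the zigzag used by the rule are ones.
      rw [if_neg (by omega), e, sweep, if_pos ⟨by omega, by omega, by omega, 1, by omega⟩,
        sweep_eq_one (k := k + 2) (by omega), show k + 2 - 1 = k + 1 from rfl,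
        sweep_eq_one (k := k + 1) (by omega)]
      have := sweep_pos (swapLetters w) t (k + 2 + 1)
      intro h
      rw [div_one, one_mul] at h
      linarith

theorem word_friezeOf (α : ℚ) : (friezeOf α).word = wordOf α := by
  have := readWord_zigzagFrieze (wordOf α) (wordOf α).length 0 (by simp)
  exact this

/-! ### Orientations -/

/-- There is an orientation of `T` that arrives at the ends NW, NE, SW, SE exactly as prescribed. -/
def Tangle.Realizes (T : Tangle) (a b c d : Bool) : Prop :=
  ∃ ω, (∀ x ∈ T.crossings, continues ω x.u₁ x.u₂ ∧ continues ω x.o₁ x.o₂) ∧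
    (headsTo ω T.nw ↔ a = true) ∧ (headsTo ω T.ne ↔ b = true) ∧ (headsTo ω T.sw ↔ c = true) ∧
      (headsTo ω T.se ↔ d = true)

/-- Orient the arcs `n` and `n + 1` towards their ends `true` according to `x` and `y`. -/
def extendOrientation (ω : ℕ → Bool) (n : ℕ) (x y : Bool) (i : ℕ) : Bool :=
  if i = n then x else if i = n + 1 then y else ω i

theorem headsTo_extend {ω : ℕ → Bool} {n : ℕ} {x y : Bool} {e : ArcEnd} (h : e.1 < n) :
    headsTo (extendOrientation ω n x y) e ↔ headsTo ω e := by
  simp [headsTo, extendOrientation, h.ne, show e.1 ≠ n + 1 by omega]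

theorem headsTo_extend_fst {ω : ℕ → Bool} {n : ℕ} {x y b : Bool} :
    headsTo (extendOrientation ω n x y) (n, b) ↔ x = b := by
  simp [headsTo, extendOrientation]

theorem headsTo_extend_snd {ω : ℕ → Bool} {n : ℕ} {x y b : Bool} :
    headsTo (extendOrientation ω n x y) (n + 1, b) ↔ y = b := by
  simp [headsTo, extendOrientation]

/-- The two strands cross, so the directions at NE and SE are interchanged. -/
theorem Tangle.Realizes.addRight {T : Tangle} (hT : T.WellFormed) {a b c d : Bool}
    (h : T.Realizes a b c d) : T.addRight.Realizes a d c b := by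
  obtain ⟨ω, hc, h1, h2, h3, h4⟩ := h
  refine ⟨extendOrientation ω T.arcs d b, ?_, ?_, ?_, ?_, ?_⟩
  · intro x hx
    rcases List.mem_cons.1 hx with rfl | hx
    · simp only [continues, headsTo_extend hT.ends.s_lt, headsTo_extend hT.ends.r_lt,
        headsTo_extend_fst, headsTo_extend_snd, h2, h4]
      cases b <;> cases d <;> simp
    · obtain ⟨l1, l2, l3, l4⟩ := hT.crossings x hx
      simpa only [continues, headsTo_extend l1, headsTo_extend l2, headsTo_extend l3,
        headsTo_extend l4] using hc x hx
  · exact (headsTo_extend hT.ends.p_lt).trans h1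
  · exact headsTo_extend_fst
  · exact (headsTo_extend hT.ends.q_lt).trans h3
  · exact headsTo_extend_snd

theorem Tangle.Realizes.addBottom {T : Tangle} (hT : T.WellFormed) {a b c d : Bool}
    (h : T.Realizes a b c d) : T.addBottom.Realizes a b d c := by
  obtain ⟨ω, hc, h1, h2, h3, h4⟩ := h
  refine ⟨extendOrientation ω T.arcs d c, ?_, ?_, ?_, ?_, ?_⟩
  · intro x hx
    rcases List.mem_cons.1 hx with rfl | hx
    · simp only [continues, headsTo_extend hT.ends.s_lt, headsTo_extend hT.ends.q_lt,
        headsTo_extend_fst, headsTo_extend_snd, h3, h4]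
      cases c <;> cases d <;> simp
    · obtain ⟨l1, l2, l3, l4⟩ := hT.crossings x hx
      simpa only [continues, headsTo_extend l1, headsTo_extend l2, headsTo_extend l3,
        headsTo_extend l4] using hc x hx
  · exact (headsTo_extend hT.ends.p_lt).trans h1
  · exact (headsTo_extend hT.ends.r_lt).trans h2
  · exact headsTo_extend_fst
  · exact headsTo_extend_snd

/-- The strands of `T` connect its ends like those of the rational tangle `p / q`, as far as
orientations are concerned. -/
def Tangle.OrientsLike (T : Tangle) (p q : ℕ) : Prop :=
  ¬ (Even p ∧ Even q) → ∀ a b c d : Bool, (Even p → b = !a ∧ d = !c) → (Even q → c = !a ∧ d = !b) →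
    (¬ Even p → ¬ Even q → d = !a ∧ c = !b) → T.Realizes a b c d

/-- A right crossing sends p/q to p/q + 1. Interchanging NE and SE permutes the three connection
patterns exactly as this does modulo 2. -/
theorem Tangle.OrientsLike.addRight {T : Tangle} (hT : T.WellFormed) {p q : ℕ}
    (h : T.OrientsLike p q) : T.addRight.OrientsLike (q + p) q := by
  intro h0 a b c d h1 h2 h3
  refine (h ?_ a d c b ?_ ?_ ?_).addRight hT
  all_goals
    by_cases hp : Even p <;> by_cases hq : Even q <;> simp_all [Nat.even_add]

theorem Tangle.OrientsLike.addBottom {T : Tangle} (hT : T.WellFormed) {p q : ℕ}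
    (h : T.OrientsLike p q) : T.addBottom.OrientsLike p (p + q) := by
  intro h0 a b c d h1 h2 h3
  refine (h ?_ a b d c ?_ ?_ ?_).addBottom hT
  all_goals
    by_cases hp : Even p <;> by_cases hq : Even q <;> simp_all [Nat.even_add]

theorem Tangle.OrientsLike.iterate_addRight {T : Tangle} (hT : T.WellFormed) {p q : ℕ}
    (h : T.OrientsLike p q) (a : ℕ) :
    (Tangle.addRight^[a] T).WellFormed ∧ (Tangle.addRight^[a] T).OrientsLike (a * q + p) q := by
  induction a with
  | zero => simpa using ⟨hT, h⟩
  | succ a ih =>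
    rw [Function.iterate_succ_apply', show (a + 1) * q + p = q + (a * q + p) by ring]
    exact ⟨ih.1.addRight, ih.2.addRight ih.1⟩

theorem Tangle.OrientsLike.iterate_addBottom {T : Tangle} (hT : T.WellFormed) {p q : ℕ}
    (h : T.OrientsLike p q) (a : ℕ) :
    (Tangle.addBottom^[a] T).WellFormed ∧ (Tangle.addBottom^[a] T).OrientsLike p (a * p + q) := by
  induction a with
  | zero => simpa using ⟨hT, h⟩
  | succ a ih =>
    rw [Function.iterate_succ_apply', show (a + 1) * p + q = p + (a * p + q) by ring]
    exact ⟨ih.1.addBottom, ih.2.addBottom ih.1⟩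

theorem Tangle.OrientsLike.zero : Tangle.zero.OrientsLike 0 1 := by
  intro _ a b c d h1 _ _
  obtain ⟨rfl, rfl⟩ := h1 Even.zero
  exact ⟨fun i => if i = 0 then !a else !c, by simp [Tangle.zero],
    by simp [Tangle.zero, headsTo]⟩

theorem Tangle.OrientsLike.infinity : Tangle.infinity.OrientsLike 1 0 := by
  intro _ a b c d _ h1 _
  obtain ⟨rfl, rfl⟩ := h1 Even.zero
  exact ⟨fun i => if i = 0 then !a else !b, by simp [Tangle.infinity],
    by simp [Tangle.infinity, headsTo]⟩

theorem rationalTangle_orientsLike (l : List ℕ) :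
    (rationalTangle l).OrientsLike (contFracPair l).1 (contFracPair l).2 ∧
      (rationalTangleHor l).OrientsLike (contFracPair l).2 (contFracPair l).1 := by
  induction l with
  | nil => exact ⟨.zero, .infinity⟩
  | cons a l ih =>
    have h := rationalTangle_hasSkein l
    exact ⟨(ih.2.iterate_addBottom h.2.1 a).2, (ih.1.iterate_addRight h.1.1 a).2⟩

theorem exists_isStandardOrientation {l : List ℕ} (hl : ∀ x ∈ l, 0 < x) :
    ∃ ω, IsStandardOrientation l ω := by
  have hcop := contFracPair_coprime l
  have hne : ¬ (Even (contFracPair l).1 ∧ Even (contFracPair l).2) := fun he =>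
    Nat.not_coprime_of_dvd_of_dvd one_lt_two he.1.two_dvd he.2.two_dvd hcop
  have h := (rationalTangle_orientsLike l).1 hne
  -- Corner directions meeting the tangle's pattern, the two closing arcs and, for even q, the
  -- antiparallel condition are chosen in each parity class.
  have key : ∃ a b c d : Bool, (rationalTangle l).Realizes a b c d ∧ c = !a ∧ d = !b ∧
      (Even (contFracPair l).2 → c = b) := by
    by_cases hp : Even (contFracPair l).1 <;> by_cases hq : Even (contFracPair l).2
    · exact absurd ⟨hp, hq⟩ hne
    · exact ⟨true, false, false, true, h _ _ _ _ (by simp) (by simp) (by simp [hp]),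
        by simp [hq]⟩
    · exact ⟨true, false, false, true, h _ _ _ _ (by simp [hp]) (by simp) (by simp [hq]),
        by simp⟩
    · exact ⟨true, true, false, false, h _ _ _ _ (by simp [hp]) (by simp) (by simp),
        by simp [hq]⟩
  obtain ⟨a, b, c, d, ⟨ω, hc, h1, h2, h3, h4⟩, e1, e2, e3⟩ := key
  refine ⟨ω, ⟨hc, ?_⟩, ?_⟩
  · intro j hj
    have : j = ((rationalTangle l).nw, (rationalTangle l).sw) ∨
        j = ((rationalTangle l).ne, (rationalTangle l).se) := by
      simpa [rationalLink, Tangle.denominator] using hj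
    rcases this with rfl | rfl
    · simp [continues, h1, h3, e1]
    · simp [continues, h2, h4, e2]
  · intro he
    rw [contFrac_den hl] at he
    rw [h2, h3, e3 he]

end RationalLink

theorem proposition4p3 (α : ℚ) (h0 : 0 < α) (h1 : α < 1)
    (a : List ℕ) (ha : ∀ x ∈ a, 0 < x) (hα : contFrac a = α) :
    (∃ ω, IsStandardOrientation a ω) ∧
    (friezeOf α).bracket = negACubedPow (weight a) * (rationalLink a).bracket ∧
    ∀ ω, IsStandardOrientation a ω →
      (rationalLink a).jones ω = negACubedPow (extWeight a ω) * (friezeOf α).bracket := by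
  subst hα
  have hb : (friezeOf (contFrac a)).bracket =
      negACubedPow (weight a) * (rationalLink a).bracket := by
    rw [Frieze.bracket, word_friezeOf, fareyBracket_wordOf ha h0 h1,
      negACubedPow_weight_mul_bracket]
  refine ⟨exists_isStandardOrientation ha, hb, fun ω _ => ?_⟩
  -- The exponents add up to minus the writhe, by definition of the extended weight.
  rw [hb, ← mul_assoc, ← negACubedPow_add, Diagram.jones, extWeight, sub_add_cancel]
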